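/- Let $G$ be a finite simple graph, let $Q$ be a subgraph of $G$, and let $k, c, m \ge 1$ be integers. For an integer $\ell\ge 0$, an edge-$\ell$-coloring of a graph is an assignment of colors from $\{1,\dots,\ell\}$ to its edges such that no two adjacent edges (that is, distinct edges sharing an endpoint) receive the same color; $\Delta(\cdot)$ denotes the maximum degree. Suppose that $\Delta(Q) \le c$ and that $Q$ has an edge-$k$-coloring $\varphi_0$ in which each color $i \in \{1,\dots,k\}$ is used on at most $m$ edges of $Q$. Then there is an edge-$\ell$-coloring $\varphi$ of $G$ with $\ell=\max\{k,\ \Delta(G)+4cm-1\}$ such that $\varphi(e) = \varphi_0(e)$ for every edge $e$ of $Q$. In particular, $\varphi_0$ extends to an edge coloring of $G$ using at most $\max\{k,\ \Delta(G)+4cm-1\}$ colors. -/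

import Mathlib

/-- An edge-`k`-coloring of a simple graph: every edge gets a color from `{1, …, k}`, and two distinct
edges which share an endpoint get different colors. -/
structure IsEdgeColoring {V : Type*} (G : SimpleGraph V) (k : ℕ) (φ : G.EdgeLabeling ℕ) : Prop where
  mem_Icc : ∀ e : G.edgeSet, φ e ∈ Finset.Icc 1 k
  ne_of_adj : ∀ e₁ e₂ : G.edgeSet, G.lineGraph.Adj e₁ e₂ → φ e₁ ≠ φ e₂

/-- The edge labeling `φ` of `G` extends the edge labeling `φ₀` of the subgraph `Q` of `G`:
it agrees with `φ₀` on every edge of `Q`. -/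
def ExtendsLabeling {V : Type*} {G : SimpleGraph V} (Q : G.Subgraph)
    (φ₀ : Q.coe.EdgeLabeling ℕ) (φ : G.EdgeLabeling ℕ) : Prop :=
  ∀ e : Q.coe.edgeSet, φ (Q.hom.mapEdgeSet e) = φ₀ e

/-! `Q` matters only through the set `F v` of colors it uses at each vertex `v`. It suffices to
color properly the graph `H` of the remaining edges from Δ(G) + 4cm - 1 colors, with no color of `F
v` at `v`. Each `F v` has at most c colors, the `H`-degree of `v` plus |`F v`| is at most Δ(G), and
each color is forbidden at no more than 2m vertices.

`exists_isAvoidingColoring` adds the edges of `H` one by one. To add `u v₀`, uncolor all edges at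
`u`; coloring them again means choosing distinct representatives of the lists `L v` of colors free
at `v` and allowed at `u`. If Hall's condition fails, let `T` be a minimal violator. The old colors
represent every list except that of `v₀`, so `T` contains `v₀` and is exactly one color short. Let
`α` be unused and allowed at `u`. Counting (`exists_color_of_hall_violator`) gives a color `β` free
at more vertices of `T` than there are vertices other than `u` forbidding `α` or `β`. Vertices of
either sort can only be ends of `α`-`β` chains, so some chain from a `β`-free vertex of `T` avoids
all forbidding vertices (`exists_kempe_swap`). Swapping it gives `T` the new color `α` without
losing `β`, which repairs Hall's condition on `T`; edges from `u` to vertices outside `T` keep their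
old colors. -/

open Finset

/-! ### Tools: components of maximum degree two, and Hall's condition -/

/-- In a finite graph of maximum degree at most two, the total deficiency `∑ (2 - deg v)` over
vertices of one connected component is at most two. -/
theorem SimpleGraph.sum_two_sub_degree_le_two {V : Type*} [Fintype V] (K : SimpleGraph V)
    [DecidableRel K.Adj] (hK : ∀ v, K.degree v ≤ 2) (x : V) (A : Finset V)
    (hA : ∀ v ∈ A, K.Reachable x v) : ∑ v ∈ A, (2 - K.degree v) ≤ 2 := by
  classical
  set D : Set V := {v | K.Reachable x v} with hD
  have hx : x ∈ D := SimpleGraph.Reachable.refl x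
  have hstep : ∀ {a b}, a ∈ D → K.Adj a b → b ∈ D := fun ha hab => ha.trans hab.reachable
  have hconn : (K.induce D).Connected := by
    have : ∀ u v (p : K.Walk u v) (hu : u ∈ D) (hv : v ∈ D),
        (K.induce D).Reachable ⟨u, hu⟩ ⟨v, hv⟩ := by
      intro u v p
      induction p with
      | nil => intro _ _; exact SimpleGraph.Reachable.refl _
      | cons hab p ih =>
        intro hu hv
        have hadj : (K.induce D).Adj ⟨_, hu⟩ ⟨_, hstep hu hab⟩ := hab
        exact hadj.reachable.trans (ih _ hv)
    rw [SimpleGraph.connected_iff_exists_forall_reachable]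
    exact ⟨⟨x, hx⟩, fun ⟨v, hv⟩ => this x v hv.some hx hv⟩
  -- A component with n vertices and e ≥ n - 1 edges has total deficiency 2n - 2e ≤ 2.
  have h1 := hconn.card_vert_le_card_edgeSet_add_one
  have h2 := (K.induce D).sum_degrees_eq_twice_card_edges
  have hdeg : ∀ v : D, (K.induce D).degree v = K.degree v := by
    intro v
    rw [← SimpleGraph.card_neighborFinset_eq_degree, ← SimpleGraph.card_neighborFinset_eq_degree,
      ← Finset.card_map (Function.Embedding.subtype _)]
    congr 1
    ext w
    simp only [mem_map, SimpleGraph.mem_neighborFinset, SimpleGraph.comap_adj,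
      Function.Embedding.subtype_apply, Subtype.exists]
    constructor
    · rintro ⟨a, ha, h, rfl⟩; exact h
    · intro h; exact ⟨w, hstep v.2 h, h, rfl⟩
  have h3 : ∑ v ∈ A, (2 - K.degree v) ≤ ∑ v ∈ D.toFinset, (2 - K.degree v) :=
    Finset.sum_le_sum_of_subset (fun v hv => by simpa [hD] using hA v hv)
  have h4 : ∑ v ∈ D.toFinset, (2 - K.degree v) + ∑ v ∈ D.toFinset, K.degree v
      = 2 * D.toFinset.card := by
    rw [← Finset.sum_add_distrib, Finset.sum_congr rfl (g := fun _ => 2)]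
    · simp [mul_comm]
    · intro v _; have := hK v; omega
  have h5 : ∑ v ∈ D.toFinset, K.degree v = 2 * (K.induce D).edgeFinset.card := by
    rw [← h2, Finset.sum_congr rfl (fun v _ => hdeg v)]
    exact (Finset.sum_subtype D.toFinset (by simp) _)
  rw [Nat.card_eq_fintype_card, Nat.card_eq_fintype_card, ← SimpleGraph.edgeFinset_card,
    ← Set.toFinset_card] at h1
  omega

/-- Hall's theorem relative to a finite set. -/
theorem Finset.exists_injOn_of_hall {ι κ : Type*} [DecidableEq κ] [Nonempty κ] (X : Finset ι)
    (t : ι → Finset κ) (h : ∀ S ⊆ X, S.card ≤ (S.biUnion t).card) :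
    ∃ g : ι → κ, Set.InjOn g X ∧ ∀ x ∈ X, g x ∈ t x := by
  classical
  rcases X.eq_empty_or_nonempty with rfl | ⟨x₀, hx₀⟩
  · exact ⟨fun _ => Classical.arbitrary κ, by simp, by simp⟩
  obtain ⟨g, hg, hgt⟩ := (Finset.all_card_le_biUnion_card_iff_exists_injective
    (fun x : X => t x)).1 (fun s => by
      have := h (s.map (Function.Embedding.subtype _)) (fun v hv => by
        simp only [mem_map] at hv; obtain ⟨a, _, rfl⟩ := hv; exact a.2)
      rw [card_map] at this
      refine this.trans (card_le_card fun v hv => ?_)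
      simp only [mem_biUnion, mem_map] at hv ⊢
      obtain ⟨_, ⟨a, ha, rfl⟩, hv⟩ := hv
      exact ⟨a, ha, hv⟩)
  refine ⟨fun i => if hi : i ∈ X then g ⟨i, hi⟩ else g ⟨x₀, hx₀⟩, ?_, ?_⟩
  · intro a ha b hb hab
    have ha' : a ∈ X := ha
    have hb' : b ∈ X := hb
    simp only [ha', hb', dif_pos] at hab
    simpa using hg hab
  · intro a ha
    simp only [ha, dif_pos]
    exact hgt ⟨a, ha⟩

/-- A minimal violator of Hall's condition satisfies the condition after `α` has been added to one
list and `β` has been replaced by `α` in some lists, if `β` remains in the union of the lists. -/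
theorem Finset.card_le_card_biUnion_of_minimal_violator {ι κ : Type*} [DecidableEq κ]
    {T : Finset ι} {L L' : ι → Finset κ} {α β : κ}
    (hT : #T ≤ #(T.biUnion L) + 1) (hmin : ∀ S ⊂ T, #S ≤ #(S.biUnion L))
    (hα : α ∉ T.biUnion L) (hsub : ∀ v ∈ T, ∀ γ ∈ L v, γ ≠ β → γ ∈ L' v)
    (hrep : ∀ v ∈ T, β ∈ L v → β ∉ L' v → α ∈ L' v) (hx : ∃ x ∈ T, α ∈ L' x)
    (hβ : β ∈ T.biUnion L → β ∈ T.biUnion L') :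
    ∀ S ⊆ T, #S ≤ #(S.biUnion L') := by
  intro S hS
  have hkeep : ∀ γ ∈ S.biUnion L, γ ≠ β → γ ∈ S.biUnion L' := by
    intro γ hγ hne
    obtain ⟨v, hv, hγ⟩ := mem_biUnion.1 hγ
    exact mem_biUnion.2 ⟨v, hv, hsub v (hS hv) γ hγ hne⟩
  have hαS : α ∉ S.biUnion L := fun h => hα (biUnion_subset_biUnion_of_subset_left _ hS h)
  rcases eq_or_ssubset_of_subset hS with rfl | hlt
  · obtain ⟨x, hxT, hx⟩ := hx
    have : insert α (S.biUnion L) ⊆ S.biUnion L' := by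
      intro γ hγ
      rcases mem_insert.1 hγ with rfl | hγ
      · exact mem_biUnion.2 ⟨x, hxT, hx⟩
      · by_cases h : γ = β
        · subst h; exact hβ hγ
        · exact hkeep γ hγ h
    have := card_le_card this
    rw [card_insert_of_notMem hα] at this
    omega
  · refine (hmin S hlt).trans ?_
    by_cases hb : β ∈ S.biUnion L → β ∈ S.biUnion L'
    · refine card_le_card fun γ hγ => ?_
      by_cases h : γ = β
      · subst h; exact hb hγ
      · exact hkeep γ hγ h
    -- If `S` loses `β`, it receives `α` in exchange, so its union does not shrink.
    · push Not at hb
      obtain ⟨v, hv, hvβ⟩ := mem_biUnion.1 hb.1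
      have hvα := hrep v (hS hv) hvβ fun h => hb.2 (mem_biUnion.2 ⟨v, hv, h⟩)
      have : insert α ((S.biUnion L).erase β) ⊆ S.biUnion L' := by
        intro γ hγ
        rcases mem_insert.1 hγ with rfl | hγ
        · exact mem_biUnion.2 ⟨v, hv, hvα⟩
        · exact hkeep γ (mem_of_mem_erase hγ) (ne_of_mem_erase hγ)
      have := card_le_card this
      rw [card_insert_of_notMem (fun h => hαS (mem_of_mem_erase h)), card_erase_of_mem hb.1] at this
      have := card_pos.2 ⟨β, hb.1⟩
      omega

/-! ### Edge colorings avoiding forbidden colors -/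

section AvoidingColoring

open scoped Classical

variable {V κ : Type*}

/-- `f a b` is the color of the edge `ab` in a proper edge coloring of `H` with colors in `C`
in which no edge at a vertex `v` has a color in `F v`. -/
structure IsAvoidingColoring (H : SimpleGraph V) (C : Finset κ) (F : V → Finset κ)
    (f : V → V → κ) : Prop where
  symm : ∀ {a b}, H.Adj a b → f a b = f b a
  mem : ∀ {a b}, H.Adj a b → f a b ∈ C
  avoid : ∀ {a b}, H.Adj a b → f a b ∉ F a
  inj : ∀ {a b c}, H.Adj a b → H.Adj a c → f a b = f a c → b = c

/-- The colors of `C` that are neither forbidden at `v` nor used by `f` on an edge of `H` at `v`. -/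
noncomputable def freeColors (H : SimpleGraph V) (C : Finset κ) (F : V → Finset κ)
    (f : V → V → κ) (v : V) : Finset κ :=
  {γ ∈ C | γ ∉ F v ∧ ∀ w, H.Adj v w → f v w ≠ γ}

theorem mem_freeColors {H : SimpleGraph V} {C : Finset κ} {F : V → Finset κ}
    {f : V → V → κ} {v : V} {γ : κ} :
    γ ∈ freeColors H C F f v ↔ γ ∈ C ∧ γ ∉ F v ∧ ∀ w, H.Adj v w → f v w ≠ γ := by
  simp [freeColors]

theorem card_le_card_freeColors_add [Fintype V] (H : SimpleGraph V) (C : Finset κ)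
    (F : V → Finset κ) (f : V → V → κ) (v : V) :
    #C ≤ #(freeColors H C F f v) + #(F v) + #{w | H.Adj v w} := by
  have h : C ⊆ freeColors H C F f v ∪ F v ∪ ({w | H.Adj v w} : Finset V).image (f v) := by
    intro γ hγ
    simp only [mem_union, mem_freeColors, mem_image, mem_filter, mem_univ, true_and]
    by_cases h1 : γ ∈ F v
    · exact Or.inl (Or.inr h1)
    by_cases h2 : ∃ w, H.Adj v w ∧ f v w = γ
    · exact Or.inr h2
    · push Not at h2
      exact Or.inl (Or.inl ⟨hγ, h1, h2⟩)
  calc #C ≤ _ := card_le_card h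
    _ ≤ _ := card_union_le _ _
    _ ≤ _ := Nat.add_le_add (card_union_le _ _) card_image_le

/-- The subgraph of the edges of color `α` or `β`. -/
def bicolored (H : SimpleGraph V) (f : V → V → κ) (α β : κ) : SimpleGraph V where
  Adj a b := H.Adj a b ∧ (f a b = α ∨ f a b = β) ∧ (f b a = α ∨ f b a = β)
  symm := ⟨fun _ _ h => ⟨h.1.symm, h.2.2, h.2.1⟩⟩
  loopless := ⟨fun _ h => H.loopless.irrefl _ h.1⟩

/-! ### Kempe chains -/

section Kempe

variable {H : SimpleGraph V} {C : Finset κ} {F : V → Finset κ} {f : V → V → κ}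

/-- Each of the two colors occurs on at most one edge at `v`, and those in `P` on none. -/
theorem IsAvoidingColoring.degree_bicolored_add_le [Fintype V] (hf : IsAvoidingColoring H C F f)
    (α β : κ) (v : V) (P : Finset κ) (hP : P ⊆ {α, β})
    (hPv : ∀ γ ∈ P, ∀ w, H.Adj v w → f v w ≠ γ) :
    (bicolored H f α β).degree v + #P ≤ 2 := by
  have h : (bicolored H f α β).degree v ≤ #(({α, β} : Finset κ) \ P) := by
    rw [← SimpleGraph.card_neighborFinset_eq_degree]
    refine card_le_card_of_injOn (f v) ?_ ?_
    · intro w hw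
      have hw' : (bicolored H f α β).Adj v w := by simpa using hw
      simp only [coe_sdiff, Set.mem_sdiff, mem_coe, mem_insert, mem_singleton]
      exact ⟨hw'.2.1, fun h => hPv _ h w hw'.1 rfl⟩
    · intro a ha b hb hab
      have ha' : (bicolored H f α β).Adj v a := by simpa using ha
      have hb' : (bicolored H f α β).Adj v b := by simpa using hb
      exact hf.inj ha'.1 hb'.1 hab
  have h2 := card_sdiff_add_card_eq_card hP
  have h3 : #({α, β} : Finset κ) ≤ 2 := card_le_two
  omega

/-- The set `D` is a union of chains, so both ends of a recolored edge lie in it; `hDF` keeps the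
exchanged colors legal. -/
theorem IsAvoidingColoring.swap_on (hf : IsAvoidingColoring H C F f) {α β : κ} (hα : α ∈ C)
    (hβ : β ∈ C) (D : Set V) (hD : ∀ a b, (bicolored H f α β).Adj a b → a ∈ D → b ∈ D)
    (hDF : ∀ v ∈ D, α ∉ F v ∧ β ∉ F v) :
    ∃ f', IsAvoidingColoring H C F f' ∧
      (∀ v ∉ D, freeColors H C F f' v = freeColors H C F f v) ∧
      ∀ v ∈ D, ∀ γ, γ ∈ freeColors H C F f' v ↔ Equiv.swap α β γ ∈ freeColors H C F f v := by
  have hC : ∀ γ, Equiv.swap α β γ ∈ C ↔ γ ∈ C := by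
    intro γ
    by_cases h1 : γ = α
    · subst h1; simp [hα, hβ]
    by_cases h2 : γ = β
    · subst h2; simp [hα, hβ]
    rw [Equiv.swap_apply_of_ne_of_ne h1 h2]
  have hF : ∀ v ∈ D, ∀ γ, Equiv.swap α β γ ∈ F v ↔ γ ∈ F v := by
    intro v hv γ
    by_cases h1 : γ = α
    · subst h1; simp [hDF v hv]
    by_cases h2 : γ = β
    · subst h2; simp [hDF v hv]
    rw [Equiv.swap_apply_of_ne_of_ne h1 h2]
  refine ⟨fun a b => if a ∈ D then Equiv.swap α β (f a b) else f a b, ⟨?_, ?_, ?_, ?_⟩, ?_, ?_⟩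
  · intro a b hab
    by_cases hcol : f a b = α ∨ f a b = β
    · have hK : (bicolored H f α β).Adj a b := ⟨hab, hcol, by rwa [← hf.symm hab]⟩
      have : a ∈ D ↔ b ∈ D := ⟨hD a b hK, hD b a hK.symm⟩
      simp only [this, hf.symm hab]
    · push Not at hcol
      have h1 := Equiv.swap_apply_of_ne_of_ne hcol.1 hcol.2
      have h2 := h1
      rw [hf.symm hab] at h2
      simp only [h2, ite_self, hf.symm hab]
  · intro a b hab
    by_cases ha : a ∈ D
    · simpa only [ha, if_true, hC] using hf.mem hab
    · simpa only [ha, if_false] using hf.mem hab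
  · intro a b hab
    by_cases ha : a ∈ D
    · simpa only [ha, if_true, hF a ha] using hf.avoid hab
    · simpa only [ha, if_false] using hf.avoid hab
  · intro a b c hab hac h
    by_cases ha : a ∈ D
    · simp only [ha, if_true] at h
      exact hf.inj hab hac ((Equiv.swap α β).injective h)
    · simp only [ha, if_false] at h
      exact hf.inj hab hac h
  · intro v hv
    ext γ
    simp only [mem_freeColors, hv, if_false]
  · intro v hv γ
    simp only [mem_freeColors, hv, if_true, hC, hF v hv, ne_eq, Equiv.swap_apply_eq_iff]

/-- If `β` is free at the vertices of `S`, and `S` has more elements than there are non-isolated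
vertices at which `α` or `β` is forbidden, then some `α`-`β` Kempe chain from a vertex of `S` can be
swapped. Besides its starting point, it has at most one vertex at which `α` or `β` is free. -/
theorem IsAvoidingColoring.exists_kempe_swap [Fintype V] (hf : IsAvoidingColoring H C F f) {α β : κ}
    (hα : α ∈ C) (hβ : β ∈ C) (hαβ : α ≠ β) (S : Finset V)
    (hS : ∀ v ∈ S, β ∈ freeColors H C F f v) (u : V) (hu : ∀ w, ¬ H.Adj u w) (huS : u ∉ S)
    (hcard : #{w | w ≠ u ∧ (α ∈ F w ∨ β ∈ F w)} < #S) :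
    ∃ x ∈ S, ∃ D : Set V, ∃ f', IsAvoidingColoring H C F f' ∧ x ∈ D ∧
      (∀ v ∉ D, freeColors H C F f' v = freeColors H C F f v) ∧
      (∀ v ∈ D, ∀ γ, γ ∈ freeColors H C F f' v ↔ Equiv.swap α β γ ∈ freeColors H C F f v) ∧
      ∀ y ∈ D, ∀ z ∈ D, β ∈ freeColors H C F f y → β ∈ freeColors H C F f z →
        y ≠ x → z ≠ x → y = z := by
  set K := bicolored H f α β with hK
  have hle : ∀ v (P : Finset κ), P ⊆ {α, β} → (∀ γ ∈ P, ∀ w, H.Adj v w → f v w ≠ γ) →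
      K.degree v + #P ≤ 2 := hf.degree_bicolored_add_le α β
  have hdeg2 : ∀ v, K.degree v ≤ 2 := fun v => (hle v ∅ (by simp) (by simp))
  have hdeg1 : ∀ v, β ∈ freeColors H C F f v → K.degree v ≤ 1 := by
    intro v hv
    have := hle v {β} (by simp) (by
      simp only [mem_singleton, forall_eq]; exact (mem_freeColors.1 hv).2.2)
    simp only [card_singleton] at this
    omega
  have hdegF : ∀ v, α ∈ F v ∨ β ∈ F v → K.degree v ≤ 1 := by
    rintro v (hv | hv)
    · have := hle v {α} (by simp) (by
        simp only [mem_singleton, forall_eq]; intro w hw h; exact hf.avoid hw (h ▸ hv))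
      simp only [card_singleton] at this
      omega
    · have := hle v {β} (by simp) (by
        simp only [mem_singleton, forall_eq]; intro w hw h; exact hf.avoid hw (h ▸ hv))
      simp only [card_singleton] at this
      omega
  have hdeg0 : ∀ v, β ∈ freeColors H C F f v → α ∈ F v ∨ β ∈ F v → K.degree v = 0 := by
    intro v hv hvF
    have hvα : α ∈ F v := hvF.resolve_right (mem_freeColors.1 hv).2.1
    have := hle v {α, β} le_rfl (by
      simp only [mem_insert, mem_singleton, forall_eq_or_imp, forall_eq]
      exact ⟨fun w hw h => hf.avoid hw (h ▸ hvα), (mem_freeColors.1 hv).2.2⟩)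
    rw [card_pair hαβ] at this
    omega
  have three : ∀ x y z, K.Reachable x y → K.Reachable x z → K.degree x ≤ 1 → K.degree y ≤ 1 →
      K.degree z ≤ 1 → y ≠ x → z ≠ x → y = z := by
    intro x y z hxy hxz hx hy hz hyx hzx
    by_contra hyz
    have := K.sum_two_sub_degree_le_two hdeg2 x {x, y, z} (by
      simp only [mem_insert, mem_singleton, forall_eq_or_imp, forall_eq]
      exact ⟨SimpleGraph.Reachable.refl x, hxy, hxz⟩)
    rw [sum_insert (by simp [hyx.symm, hzx.symm]), sum_pair hyz] at this
    omega
  have two : ∀ x y, K.Reachable x y → K.degree x = 0 → K.degree y ≤ 1 → y = x := by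
    intro x y hxy hx hy
    by_contra hyx
    have := K.sum_two_sub_degree_le_two hdeg2 x {x, y} (by
      simp only [mem_insert, mem_singleton, forall_eq_or_imp, forall_eq]
      exact ⟨SimpleGraph.Reachable.refl x, hxy⟩)
    rw [sum_pair (Ne.symm hyx)] at this
    omega
  -- Otherwise each `x` in `S` reaches a forbidding vertex `b x`. As both are chain ends, `b` is
  -- injective, and it misses the isolated vertex `u`, contradicting `hcard`.
  obtain ⟨x, hxS, hx⟩ : ∃ x ∈ S, ∀ b, K.Reachable x b → ¬ (α ∈ F b ∨ β ∈ F b) := by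
    by_contra! hcon
    choose! b hb hbF using hcon
    refine absurd (card_le_card_of_injOn b (s := S) ?_ ?_) (not_le.2 hcard)
    · intro x hx
      have hxS : x ∈ S := hx
      simp only [coe_filter, mem_univ, true_and, Set.mem_ofPred_eq]
      refine ⟨?_, hbF x hxS⟩
      intro hbu
      have h0 : K.degree u = 0 := by
        rw [SimpleGraph.degree_eq_zero]
        intro w hw
        exact hu w hw.1
      have := two u x (hbu ▸ (hb x hxS).symm) h0 (hdeg1 x (hS x hxS))
      exact huS (this ▸ hxS)
    · intro x hx y hy hxy
      have hx : x ∈ S := hx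
      have hy : y ∈ S := hy
      have hbx := hb x hx
      have hby : K.Reachable (b x) y := hxy ▸ (hb y hy).symm
      by_contra hne
      by_cases h1 : x = b x
      · exact hne (two x y (hbx.trans hby) (hdeg0 x (hS x hx) (h1 ▸ hbF x hx))
          (hdeg1 y (hS y hy))).symm
      by_cases h2 : y = b x
      · exact hne (two y x (hbx.trans hby).symm
          (hdeg0 y (hS y hy) (by rw [h2]; exact hbF x hx)) (hdeg1 x (hS x hx)))
      · exact hne (three (b x) x y hbx.symm hby (hdegF _ (hbF x hx)) (hdeg1 x (hS x hx))
          (hdeg1 y (hS y hy)) h1 h2)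
  obtain ⟨f', hf', h1, h2⟩ := hf.swap_on hα hβ {v | K.Reachable x v}
    (fun a b hab ha => SimpleGraph.Reachable.trans ha hab.reachable)
    (fun v hv => not_or.1 (hx v hv))
  refine ⟨x, hxS, _, f', hf', SimpleGraph.Reachable.refl x, h1, h2, ?_⟩
  intro y hy z hz hyβ hzβ hyx hzx
  exact three x y z hy hz (hdeg1 x (hS x hxS)) (hdeg1 y hyβ) (hdeg1 z hzβ) hyx hzx

end Kempe

/-! ### Recoloring the edges at one vertex -/

variable {H : SimpleGraph V} {C : Finset κ} {F : V → Finset κ} {f : V → V → κ}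

/-- The graph `H` without the edges at `u`. -/
def isolateVertex (H : SimpleGraph V) (u : V) : SimpleGraph V where
  Adj a b := H.Adj a b ∧ a ≠ u ∧ b ≠ u
  symm := ⟨fun _ _ h => ⟨h.1.symm, h.2.2, h.2.1⟩⟩
  loopless := ⟨fun _ h => H.loopless.irrefl _ h.1⟩

/-- A system of distinct representatives for the colors available on the edges at `u` extends a
coloring to these edges. -/
theorem IsAvoidingColoring.extend_at {u : V}
    (hf : IsAvoidingColoring (isolateVertex H u) C F f) (g : V → κ)
    (hg : Set.InjOn g {v | H.Adj u v})
    (hgL : ∀ v, H.Adj u v → g v ∈ freeColors (isolateVertex H u) C F f v \ F u) :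
    ∃ f', IsAvoidingColoring H C F f' := by
  have key : ∀ v, H.Adj u v → g v ∈ C ∧ g v ∉ F v ∧ g v ∉ F u ∧
      ∀ w, H.Adj v w → w ≠ u → f v w ≠ g v := by
    intro v hv
    have h := mem_sdiff.1 (hgL v hv)
    have h' := mem_freeColors.1 h.1
    exact ⟨h'.1, h'.2.1, h.2, fun w hw hwu => h'.2.2 w ⟨hw, hv.ne', hwu⟩⟩
  refine ⟨fun a b => if a = u then g b else if b = u then g a else f a b, ?_, ?_, ?_, ?_⟩
  · intro a b hab
    by_cases ha : a = u <;> by_cases hb : b = u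
    · exact absurd (ha.trans hb.symm) hab.ne
    · simp [ha, hb]
    · simp [ha, hb]
    · simpa [ha, hb] using hf.symm ⟨hab, ha, hb⟩
  · intro a b hab
    by_cases ha : a = u
    · subst ha; simpa using (key b hab).1
    by_cases hb : b = u
    · subst hb; simpa [ha] using (key a hab.symm).1
    · simpa [ha, hb] using hf.mem ⟨hab, ha, hb⟩
  · intro a b hab
    by_cases ha : a = u
    · subst ha; simpa using (key b hab).2.2.1
    by_cases hb : b = u
    · subst hb; simpa [ha] using (key a hab.symm).2.1
    · simpa [ha, hb] using hf.avoid ⟨hab, ha, hb⟩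
  · intro a b c hab hac h
    by_cases ha : a = u
    · subst ha
      simp only [if_true] at h
      exact hg hab hac h
    simp only [ha, if_false] at h
    by_cases hb : b = u <;> by_cases hc : c = u
    · exact hb.trans hc.symm
    · simp only [hb, hc, if_true, if_false] at h
      subst hb
      exact absurd h.symm ((key a hab.symm).2.2.2 c hac hc)
    · simp only [hb, hc, if_true, if_false] at h
      subst hc
      exact absurd h ((key a hac.symm).2.2.2 b hab hb)
    · simp only [hb, hc, if_false] at h
      exact hf.inj ⟨hab, ha, hb⟩ ⟨hac, ha, hc⟩ h

/-- If Hall's condition fails for the colors available on the edges at `u`, by a minimal violator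
`T`, and many vertices of `T` have `β` free, then a Kempe swap repairs the condition on `T`. -/
theorem IsAvoidingColoring.exists_swap_hall [Fintype V] {u : V}
    (hf : IsAvoidingColoring (isolateVertex H u) C F f) {T : Finset V} (huT : u ∉ T)
    {L : V → Finset κ} (hL : L = fun v => freeColors (isolateVertex H u) C F f v \ F u)
    (hT : #T ≤ #(T.biUnion L) + 1) (hmin : ∀ S ⊂ T, #S ≤ #(S.biUnion L)) {α β : κ}
    (hα : α ∈ C) (hαu : α ∉ F u) (hαT : α ∉ T.biUnion L) (hβ : β ∈ T.biUnion L ∪ F u)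
    (hn : β ∉ F u → 3 ≤ #{v ∈ T | β ∈ freeColors (isolateVertex H u) C F f v})
    (hcard : #{w | w ≠ u ∧ (α ∈ F w ∨ β ∈ F w)} <
      #{v ∈ T | β ∈ freeColors (isolateVertex H u) C F f v}) :
    ∃ f' L', IsAvoidingColoring (isolateVertex H u) C F f' ∧
      (L' = fun v => freeColors (isolateVertex H u) C F f' v \ F u) ∧
      (∀ S ⊆ T, #S ≤ #(S.biUnion L')) ∧ (∀ v ∈ T, L' v ⊆ insert α (L v)) ∧
      ∀ v, ∀ γ ∈ L v, γ ≠ α → γ ≠ β → γ ∈ L' v := by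
  set H₀ := isolateVertex H u with hH₀
  have memL : ∀ v γ, γ ∈ L v ↔ γ ∈ freeColors H₀ C F f v ∧ γ ∉ F u := by
    intro v γ; rw [hL]; exact mem_sdiff
  have hαfree : ∀ v ∈ T, α ∉ freeColors H₀ C F f v := fun v hv h =>
    hαT (mem_biUnion.2 ⟨v, hv, (memL v α).2 ⟨h, hαu⟩⟩)
  obtain ⟨x₀, hx₀⟩ : ({v ∈ T | β ∈ freeColors H₀ C F f v} : Finset V).Nonempty :=
    card_pos.1 (by omega)
  have hx₀' := mem_filter.1 hx₀
  have hβC : β ∈ C := (mem_freeColors.1 hx₀'.2).1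
  have hαβ : α ≠ β := by rintro rfl; exact hαfree x₀ hx₀'.1 hx₀'.2
  obtain ⟨x, hxS, D, f', hf', hxD, hout, hin, hends⟩ := hf.exists_kempe_swap hα hβC hαβ
    {v ∈ T | β ∈ freeColors H₀ C F f v} (fun v hv => (mem_filter.1 hv).2) u
    (fun w hw => hw.2.1 rfl) (fun h => huT (mem_filter.1 h).1) hcard
  obtain ⟨hxT, hxβ⟩ := mem_filter.1 hxS
  have memL' : ∀ v γ, γ ∈ freeColors H₀ C F f' v \ F u ↔
      γ ∈ freeColors H₀ C F f' v ∧ γ ∉ F u := fun v γ => mem_sdiff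
  have hkeep : ∀ v, ∀ γ ∈ L v, γ ≠ α → γ ≠ β → γ ∈ freeColors H₀ C F f' v \ F u := by
    intro v γ hγ h1 h2
    rw [memL] at hγ
    refine (memL' v γ).2 ⟨?_, hγ.2⟩
    by_cases hv : v ∈ D
    · rw [hin v hv, Equiv.swap_apply_of_ne_of_ne h1 h2]; exact hγ.1
    · rw [hout v hv]; exact hγ.1
  have hgain : ∀ v ∈ D, β ∈ freeColors H₀ C F f v → α ∈ freeColors H₀ C F f' v \ F u := by
    intro v hv h
    refine (memL' v α).2 ⟨?_, hαu⟩
    rw [hin v hv, Equiv.swap_apply_left]; exact h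
  refine ⟨f', _, hf', rfl, ?_, ?_, hkeep⟩
  · refine Finset.card_le_card_biUnion_of_minimal_violator (α := α) (β := β) hT hmin hαT ?_ ?_
      ⟨x, hxT, hgain x hxD hxβ⟩ ?_
    · intro v hv γ hγ hne
      refine hkeep v γ hγ ?_ hne
      rintro rfl
      exact hαfree v hv ((memL _ _).1 hγ).1
    · intro v hv h1 h2
      rw [memL] at h1
      refine hgain v ?_ h1.1
      by_contra hvD
      exact h2 ((memL' v β).2 ⟨by rw [hout v hvD]; exact h1.1, h1.2⟩)
    · intro hβT
      obtain ⟨v, -, hβv⟩ := mem_biUnion.1 hβT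
      have hβu := ((memL v β).1 hβv).2
      -- The chain has at most two `β`-free vertices, and `T` has at least three.
      obtain ⟨z, hz, hzD⟩ : ∃ z ∈ ({v ∈ T | β ∈ freeColors H₀ C F f v} : Finset V), z ∉ D := by
        by_contra! hcon
        have h2 : 1 < #(({v ∈ T | β ∈ freeColors H₀ C F f v} : Finset V).erase x) := by
          rw [card_erase_of_mem hxS]; have := hn hβu; omega
        obtain ⟨y, hy, z, hz, hyz⟩ := one_lt_card.1 h2
        rw [mem_erase] at hy hz
        exact hyz (hends y (hcon y hy.2) z (hcon z hz.2) (mem_filter.1 hy.2).2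
          (mem_filter.1 hz.2).2 hy.1 hz.1)
      rw [mem_filter] at hz
      exact mem_biUnion.2 ⟨z, hz.1, (memL' z β).2 ⟨by rw [hout z hzD]; exact hz.2, hβu⟩⟩
  · intro v hv γ hγ
    rw [memL'] at hγ
    rw [mem_insert, memL]
    by_cases h1 : γ = α
    · exact Or.inl h1
    refine Or.inr ⟨?_, hγ.2⟩
    by_cases hvD : v ∈ D
    · by_cases h2 : γ = β
      · subst h2
        have := (hin v hvD γ).1 hγ.1
        rw [Equiv.swap_apply_right] at this
        exact absurd this (hαfree v hv)
      · have := (hin v hvD γ).1 hγ.1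
        rwa [Equiv.swap_apply_of_ne_of_ne h1 h2] at this
    · rw [← hout v hvD]; exact hγ.1

/-! ### Counting and the induction on edges -/

/-- The counting step: some color is free at many vertices of a Hall violator. -/
theorem Finset.exists_color_of_hall_violator {T : Finset V} {M : V → Finset κ} {Γ Φ : Finset κ}
    {c m : ℕ} (hc : 1 ≤ c) (hm : 1 ≤ m) (hM : ∀ v ∈ T, M v ⊆ Γ ∪ Φ)
    (hMc : ∀ v ∈ T, 4 * c * m ≤ #(M v)) (hΓ : #Γ < #T) (hΦ : #Φ ≤ c) :
    ∃ β ∈ Γ ∪ Φ, (β ∉ Φ → 4 * m + 1 ≤ #{v ∈ T | β ∈ M v}) ∧ 4 * m ≤ #{v ∈ T | β ∈ M v} := by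
  by_contra! hcon
  have h1 : ∑ v ∈ T, #(M v) = ∑ β ∈ Γ ∪ Φ, #{v ∈ T | β ∈ M v} := by
    refine Eq.trans ?_ (sum_card_bipartiteAbove_eq_sum_card_bipartiteBelow (fun v β => β ∈ M v))
    refine sum_congr rfl fun v hv => ?_
    congr 1
    ext β
    simp only [bipartiteAbove, mem_filter]
    exact ⟨fun h => ⟨hM v hv h, h⟩, fun h => h.2⟩
  -- This bound is at most (|T| - 1)4m + c(4m - 1), which is below the lower bound 4cm|T|.
  have h2 : ∑ β ∈ Γ ∪ Φ, #{v ∈ T | β ∈ M v} ≤ ∑ β ∈ Γ \ Φ, 4 * m + ∑ β ∈ Φ, (4 * m - 1) := by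
    rw [← sdiff_union_self_eq_union, sum_union sdiff_disjoint]
    refine Nat.add_le_add (sum_le_sum fun β hβ => ?_) (sum_le_sum fun β hβ => ?_)
    · rw [mem_sdiff] at hβ
      by_contra hlt
      have := hcon β (mem_union_left _ hβ.1) (fun _ => by omega)
      omega
    · have := hcon β (mem_union_right _ hβ) (fun h => absurd hβ h)
      omega
  have h3 : #T * (4 * c * m) ≤ ∑ v ∈ T, #(M v) := by
    simpa using card_nsmul_le_sum T (fun v => #(M v)) _ hMc
  rw [sum_const, sum_const, smul_eq_mul, smul_eq_mul] at h2
  have h4 : #(Γ \ Φ) ≤ #Γ := card_le_card sdiff_subset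
  obtain ⟨t, ht⟩ : ∃ t, #T = t + 1 := ⟨#T - 1, by omega⟩
  obtain ⟨n, rfl⟩ : ∃ n, m = n + 1 := ⟨m - 1, by omega⟩
  have h5 : #(Γ \ Φ) * (4 * (n + 1)) ≤ t * (4 * (n + 1)) := Nat.mul_le_mul_right _ (by omega)
  have h6 : #Φ * (4 * (n + 1) - 1) ≤ c * (4 * (n + 1) - 1) := Nat.mul_le_mul_right _ hΦ
  have h7 : 4 * (n + 1) - 1 = 4 * n + 3 := by omega
  rw [h7] at h6
  rw [h7] at h2
  rw [ht] at h3
  have h8 : t * (4 * (n + 1)) * 1 ≤ t * (4 * (n + 1)) * c := Nat.mul_le_mul_left _ hc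
  nlinarith

/-- A coloring of all edges but one can be turned into a coloring of all edges. -/
theorem IsAvoidingColoring.exists_of_deleteEdge [Fintype V] [Nonempty κ] {Δ c m : ℕ}
    (hc : 1 ≤ c) (hm : 1 ≤ m) (hdeg : ∀ v, #{w | H.Adj v w} + #(F v) ≤ Δ)
    (hF : ∀ v, #(F v) ≤ c) (hFα : ∀ α, #{v | α ∈ F v} ≤ 2 * m) (hC : Δ + 4 * c * m ≤ #C + 1)
    {u v₀ : V} (huv : H.Adj u v₀) (hf : IsAvoidingColoring (H.deleteEdges {s(u, v₀)}) C F f) :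
    ∃ f', IsAvoidingColoring H C F f' := by
  have hadj : ∀ a b, (H.deleteEdges {s(u, v₀)}).Adj a b ↔ H.Adj a b ∧ s(a, b) ≠ s(u, v₀) := by
    intro a b; simp [SimpleGraph.deleteEdges_adj]
  have hadju : ∀ v, v ≠ v₀ → H.Adj u v → (H.deleteEdges {s(u, v₀)}).Adj u v := by
    intro v hv h
    refine (hadj _ _).2 ⟨h, ?_⟩
    simpa [huv.ne] using hv
  have hle : ∀ a b, (isolateVertex H u).Adj a b → (H.deleteEdges {s(u, v₀)}).Adj a b := by
    rintro a b ⟨hab, ha, hb⟩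
    refine (hadj _ _).2 ⟨hab, ?_⟩
    simp [ha, hb]
  have hf₀ : IsAvoidingColoring (isolateVertex H u) C F f :=
    ⟨fun h => hf.symm (hle _ _ h), fun h => hf.mem (hle _ _ h), fun h => hf.avoid (hle _ _ h),
      fun h h' => hf.inj (hle _ _ h) (hle _ _ h')⟩
  set X : Finset V := {v | H.Adj u v} with hX
  have memX : ∀ v, v ∈ X ↔ H.Adj u v := by simp [hX]
  obtain ⟨L, hL⟩ : ∃ L, L = fun v => freeColors (isolateVertex H u) C F f v \ F u := ⟨_, rfl⟩
  have hμ : ∀ v ∈ X, v ≠ v₀ → f u v ∈ L v := by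
    intro v hv hne
    have h := hadju v hne ((memX v).1 hv)
    have hs := hf.symm h
    rw [hL, mem_sdiff, mem_freeColors]
    refine ⟨⟨hf.mem h, ?_, ?_⟩, hf.avoid h⟩
    · rw [hs]; exact hf.avoid h.symm
    · intro w hw hfw
      rw [hs] at hfw
      exact hw.2.2 (hf.inj (hle _ _ hw) h.symm hfw)
  have hμinj : Set.InjOn (f u) (X.erase v₀) := by
    intro a ha b hb hab
    rw [mem_coe, mem_erase, memX] at ha hb
    exact hf.inj (hadju a ha.1 ha.2) (hadju b hb.1 hb.2) hab
  by_cases hHall : ∀ S ⊆ X, #S ≤ #(S.biUnion L)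
  · obtain ⟨g, hg, hgL⟩ := Finset.exists_injOn_of_hall X L hHall
    refine hf₀.extend_at g (by simpa [hX] using hg) fun v hv => ?_
    simpa only [hL] using hgL v ((memX v).2 hv)
  push Not at hHall
  obtain ⟨T, ⟨hTX, hTlt⟩, hTmin⟩ : ∃ T, (T ⊆ X ∧ #(T.biUnion L) < #T) ∧
      ∀ S ⊂ T, #S ≤ #(S.biUnion L) := by
    obtain ⟨S₀, hS₀⟩ := hHall
    obtain ⟨T, hT⟩ := exists_minimal_of_wellFoundedLT
      (fun S : Finset V => S ⊆ X ∧ #(S.biUnion L) < #S) ⟨S₀, hS₀⟩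
    refine ⟨T, hT.prop, fun S hS => ?_⟩
    by_contra! hlt
    exact hT.not_lt ⟨hS.subset.trans hT.prop.1, hlt⟩ hS
  have huX : u ∉ X := by simp [memX]
  have himg : (T.erase v₀).image (f u) ⊆ T.biUnion L := by
    intro γ hγ
    obtain ⟨v, hv, rfl⟩ := mem_image.1 hγ
    rw [mem_erase] at hv
    exact mem_biUnion.2 ⟨v, hv.2, hμ v (hTX hv.2) hv.1⟩
  have hcardimg : #((T.erase v₀).image (f u)) = #(T.erase v₀) :=
    card_image_of_injOn (hμinj.mono (by exact_mod_cast erase_subset_erase _ hTX))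
  have hv₀T : v₀ ∈ T := by
    by_contra h
    have := card_le_card himg
    rw [hcardimg, erase_eq_of_notMem h] at this
    omega
  -- The |T| - 1 old colors lie in a union of fewer than |T| colors, hence exhaust it.
  have himgeq : (T.erase v₀).image (f u) = T.biUnion L := by
    refine eq_of_subset_of_card_le himg ?_
    rw [hcardimg, card_erase_of_mem hv₀T]
    omega
  have hTle : #T ≤ #(T.biUnion L) + 1 := by
    rw [← himgeq, hcardimg, card_erase_of_mem hv₀T]; omega
  have hμout : ∀ v ∈ X, v ∉ T → f u v ∉ T.biUnion L := by
    intro v hv hvT h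
    rw [← himgeq] at h
    obtain ⟨w, hw, hwv⟩ := mem_image.1 h
    have hvv₀ : v ≠ v₀ := by rintro rfl; exact hvT hv₀T
    have hw' := mem_erase.1 hw
    have := hμinj (by simp [hw'.1, hTX hw'.2]) (by simp [hvv₀, hv]) hwv
    exact hvT (this ▸ hw'.2)
  have hXcard : #X + #(F u) ≤ Δ := hdeg u
  have hXpos : 0 < #X := card_pos.2 ⟨v₀, (memX v₀).2 huv⟩
  obtain ⟨α, hαC, hα⟩ : ∃ α ∈ C, α ∉ F u ∪ (X.erase v₀).image (f u) := by
    have h1 : #(F u ∪ (X.erase v₀).image (f u)) ≤ #(F u) + (#X - 1) := by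
      refine (card_union_le _ _).trans (Nat.add_le_add le_rfl ?_)
      rw [← card_erase_of_mem ((memX v₀).2 huv)]
      exact card_image_le
    have h2 : 0 < 4 * c * m := by positivity
    exact exists_mem_notMem_of_card_lt_card (by omega)
  rw [mem_union, not_or] at hα
  have hαμ : ∀ v ∈ X, v ≠ v₀ → f u v ≠ α := fun v hv hne h =>
    hα.2 (mem_image.2 ⟨v, mem_erase.2 ⟨hne, hv⟩, h⟩)
  have hαT : α ∉ T.biUnion L := by
    rw [← himgeq]
    intro h
    obtain ⟨w, hw, hwα⟩ := mem_image.1 h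
    exact hαμ w (hTX (mem_of_mem_erase hw)) (ne_of_mem_erase hw) hwα
  obtain ⟨β, hβ, hβ1, hβ2⟩ := Finset.exists_color_of_hall_violator (T := T)
    (M := freeColors (isolateVertex H u) C F f) (Γ := T.biUnion L) (Φ := F u) hc hm
    (by
      intro v hv γ hγ
      by_cases h : γ ∈ F u
      · exact mem_union_right _ h
      · refine mem_union_left _ (mem_biUnion.2 ⟨v, hv, ?_⟩)
        rw [hL]; exact mem_sdiff.2 ⟨hγ, h⟩)
    (by
      -- The edge `uv` is uncolored, so at least |C| - (Δ - 1) ≥ 4cm colors are free at `v`.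
      intro v hv
      have h1 := card_le_card_freeColors_add (isolateVertex H u) C F f v
      have h2 : #{w | (isolateVertex H u).Adj v w} < #{w | H.Adj v w} := by
        refine card_lt_card ⟨?_, ?_⟩
        · intro w hw
          simp only [mem_filter, mem_univ, true_and] at hw ⊢
          exact hw.1
        · intro h
          have : u ∈ ({w | (isolateVertex H u).Adj v w} : Finset V) :=
            h (by simpa using ((memX v).1 (hTX hv)).symm)
          simp only [mem_filter, mem_univ, true_and] at this
          exact this.2.2 rfl
      have h3 := hdeg v
      omega)
    hTlt (hF u)
  have hbad : #{w | w ≠ u ∧ (α ∈ F w ∨ β ∈ F w)} <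
      #{v ∈ T | β ∈ freeColors (isolateVertex H u) C F f v} := by
    have h1 := hFα α
    have h2 := hFα β
    have h3 : ({w | w ≠ u ∧ (α ∈ F w ∨ β ∈ F w)} : Finset V) ⊆
        ({v | α ∈ F v} : Finset V) ∪ ({v | β ∈ F v} : Finset V).erase u := by
      intro w hw
      simp only [mem_filter, mem_univ, true_and, mem_union, mem_erase] at hw ⊢
      tauto
    have h4 := (card_le_card h3).trans (card_union_le _ _)
    -- If `β` is forbidden at `u`, discarding `u` leaves at most 4m - 1 forbidding vertices; this
    -- makes up for the weaker bound 4m on the `β`-free vertices.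
    by_cases hβu : β ∈ F u
    · rw [card_erase_of_mem (by simpa using hβu)] at h4
      omega
    · have h5 := hβ1 hβu
      have h6 : #(({v | β ∈ F v} : Finset V).erase u) ≤ #({v | β ∈ F v} : Finset V) :=
        card_le_card (erase_subset _ _)
      omega
  obtain ⟨f', L', hf', hL', hHall', hsub, hkeep⟩ := hf₀.exists_swap_hall (fun h => huX (hTX h)) hL
    hTle hTmin hαC hα.1 hαT hβ (fun h => by have := hβ1 h; omega) hbad
  obtain ⟨g, hg, hgL⟩ := Finset.exists_injOn_of_hall T L' hHall'
  have hgT : ∀ v ∈ T, g v = α ∨ g v ∈ T.biUnion L := by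
    intro v hv
    rcases mem_insert.1 (hsub v hv (hgL v hv)) with h | h
    · exact Or.inl h
    · exact Or.inr (mem_biUnion.2 ⟨v, hv, h⟩)
  have hne₀ : ∀ v, v ∉ T → v ≠ v₀ := by rintro v hv rfl; exact hv hv₀T
  have hdisj : ∀ a ∈ X, a ∈ T → ∀ b ∈ X, b ∉ T → g a ≠ f u b := by
    intro a _ haT b hb hbT h
    rcases hgT a haT with h' | h'
    · exact hαμ b hb (hne₀ b hbT) (h.symm.trans h')
    · exact hμout b hb hbT (h ▸ h')
  -- On `T` only `α` and old colors of edges from `u` to `T` are used, so the old colors outside `T`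
  -- cause no conflict.
  refine hf'.extend_at (fun v => if v ∈ T then g v else f u v) ?_ ?_
  · intro a ha b hb hab
    have ha' := (memX a).2 ha
    have hb' := (memX b).2 hb
    by_cases haT : a ∈ T <;> by_cases hbT : b ∈ T <;> simp only [haT, hbT, if_true, if_false] at hab
    · exact hg haT hbT hab
    · exact absurd hab (hdisj a ha' haT b hb' hbT)
    · exact absurd hab.symm (hdisj b hb' hbT a ha' haT)
    · exact hμinj (by simp [hne₀ a haT, ha']) (by simp [hne₀ b hbT, hb']) hab
  · intro v hv
    have hv' := (memX v).2 hv
    have h : (if v ∈ T then g v else f u v) ∈ L' v := by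
      by_cases hvT : v ∈ T
      · simpa only [hvT, if_true] using hgL v hvT
      · simp only [hvT, if_false]
        refine hkeep v _ (hμ v hv' (hne₀ v hvT)) (hαμ v hv' (hne₀ v hvT)) ?_
        rintro rfl
        rcases mem_union.1 hβ with h | h
        · exact hμout v hv' hvT h
        · exact hf.avoid (hadju v (hne₀ v hvT) hv) h
    simpa only [hL'] using h

/-- A graph whose vertices have at most `c` forbidden colors each, every color being forbidden at
at most `2 * m` vertices, has an edge coloring avoiding the forbidden colors. -/
theorem exists_isAvoidingColoring [Fintype V] [Nonempty κ] (H : SimpleGraph V) (C : Finset κ)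
    (F : V → Finset κ) {Δ c m : ℕ} (hc : 1 ≤ c) (hm : 1 ≤ m)
    (hdeg : ∀ v, #{w | H.Adj v w} + #(F v) ≤ Δ) (hF : ∀ v, #(F v) ≤ c)
    (hFα : ∀ α, #{v | α ∈ F v} ≤ 2 * m) (hC : Δ + 4 * c * m ≤ #C + 1) :
    ∃ f, IsAvoidingColoring H C F f := by
  induction hn : #H.edgeFinset generalizing H with
  | zero =>
    have hH : H = ⊥ := by simpa using hn
    subst hH
    exact ⟨fun _ _ => Classical.arbitrary κ, ⟨False.elim, False.elim, False.elim, False.elim⟩⟩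
  | succ n ih =>
    obtain ⟨e, he⟩ : H.edgeFinset.Nonempty := card_pos.1 (by omega)
    induction e with
    | _ u v₀ =>
    have huv : H.Adj u v₀ := by simpa using he
    obtain ⟨f, hf⟩ := ih (H.deleteEdges {s(u, v₀)}) (fun v => by
        refine le_trans (Nat.add_le_add_right (card_le_card fun w hw => ?_) _) (hdeg v)
        simp only [mem_filter, mem_univ, true_and] at hw ⊢
        exact (H.deleteEdges_le _) hw) (by
      have h1 : (H.deleteEdges {s(u, v₀)}).edgeFinset = H.edgeFinset.erase s(u, v₀) := by
        ext e
        simp only [SimpleGraph.mem_edgeFinset, SimpleGraph.edgeSet_deleteEdges, mem_erase,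
          Set.mem_sdiff, Set.mem_singleton_iff]
        tauto
      have h2 := congrArg card h1
      rw [card_erase_of_mem he, hn] at h2
      rw [Nat.add_sub_cancel] at h2
      convert h2)
    exact hf.exists_of_deleteEdge hc hm hdeg hF hFα hC huv

end AvoidingColoring

/-! ### From the precoloring to forbidden colors -/

theorem mainTheorem3 {V : Type*} [Fintype V] (G : SimpleGraph V) [DecidableRel G.Adj]
    (Q : G.Subgraph) [Fintype Q.verts] [DecidableRel Q.coe.Adj]
    (k c m : ℕ) (hk : 1 ≤ k) (hc : 1 ≤ c) (hm : 1 ≤ m)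
    (hQ : Q.coe.maxDegree ≤ c)
    (φ₀ : Q.coe.EdgeLabeling ℕ) (hφ₀ : IsEdgeColoring Q.coe k φ₀)
    (hcol : ∀ i ∈ Finset.Icc 1 k, {e : Q.coe.edgeSet | φ₀ e = i}.ncard ≤ m) :
    ∃ φ : G.EdgeLabeling ℕ,
      IsEdgeColoring G (max k (G.maxDegree + 4 * c * m - 1)) φ ∧ ExtendsLabeling Q φ₀ φ := by
  classical
  let qe : ∀ {a b}, Q.Adj a b → Q.coe.edgeSet := fun {a b} h =>
    ⟨s(⟨a, Q.edge_vert h⟩, ⟨b, Q.edge_vert h.symm⟩), h⟩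
  let q : V → V → ℕ := fun a b => if h : Q.Adj a b then φ₀ (qe h) else 0
  have q_eq : ∀ {a b} (h : Q.Adj a b), q a b = φ₀ (qe h) := fun h => dif_pos h
  have qe_symm : ∀ {a b} (h : Q.Adj a b), qe h = qe h.symm := fun h => Subtype.ext Sym2.eq_swap
  have q_symm : ∀ {a b}, Q.Adj a b → q a b = q b a := fun h => by
    rw [q_eq h, q_eq h.symm, qe_symm]
  have q_inj : ∀ {a b b'}, Q.Adj a b → Q.Adj a b' → q a b = q a b' → b = b' := by
    intro a b b' h h' hqq
    by_contra hne
    rw [q_eq h, q_eq h'] at hqq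
    refine hφ₀.ne_of_adj (qe h) (qe h') ?_ hqq
    rw [SimpleGraph.lineGraph_adj_iff_exists]
    refine ⟨fun heq => hne ?_, ⟨a, Q.edge_vert h⟩, Sym2.mem_mk_left _ _, Sym2.mem_mk_left _ _⟩
    have := congrArg Subtype.val heq
    simpa [qe, h'.ne] using this
  let F : V → Finset ℕ := fun v => ({w | Q.Adj v w} : Finset V).image (q v)
  let H : SimpleGraph V := G \ Q.spanningCoe
  have hH : ∀ a b, H.Adj a b ↔ G.Adj a b ∧ ¬ Q.Adj a b := fun a b => by simp [H]
  have hFQ : ∀ v, #(F v) ≤ #({w | Q.Adj v w} : Finset V) := fun v => card_image_le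
  have hQdeg : ∀ v, #({w | Q.Adj v w} : Finset V) ≤ c := by
    intro v
    by_cases hv : v ∈ Q.verts
    · refine le_trans ?_ ((Q.coe.degree_le_maxDegree ⟨v, hv⟩).trans hQ)
      rw [← SimpleGraph.card_neighborFinset_eq_degree,
        ← card_map (Function.Embedding.subtype _)]
      refine card_le_card fun w hw => ?_
      have hw' : Q.Adj v w := by simpa using hw
      simp only [mem_map, SimpleGraph.mem_neighborFinset]
      exact ⟨⟨w, Q.edge_vert hw'.symm⟩, hw', rfl⟩
    · have : ({w | Q.Adj v w} : Finset V) = ∅ := by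
        ext w
        simpa using fun hw => hv (Q.edge_vert hw)
      simp [this]
  have hdeg : ∀ v, #({w | H.Adj v w} : Finset V) + #(F v) ≤ G.maxDegree := by
    intro v
    refine (Nat.add_le_add_left (hFQ v) _).trans (le_trans ?_ (G.degree_le_maxDegree v))
    rw [← SimpleGraph.card_neighborFinset_eq_degree, ← card_union_of_disjoint]
    · refine card_le_card fun w hw => ?_
      simp only [mem_union, mem_filter, mem_univ, true_and, hH] at hw
      rw [SimpleGraph.mem_neighborFinset]
      exact hw.elim And.left fun h => h.adj_sub
    · rw [disjoint_left]
      intro w hw hw'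
      simp only [mem_filter, mem_univ, true_and, hH] at hw hw'
      exact hw.2 hw'
  -- A vertex forbidding `α` is an end of one of the at most m edges of `Q` colored `α`.
  have hFα : ∀ α, #({v | α ∈ F v} : Finset V) ≤ 2 * m := by
    intro α
    have hsub : ({v | α ∈ F v} : Finset V) ⊆ ({e | φ₀ e = α} : Finset Q.coe.edgeSet).biUnion
        fun e => e.1.toFinset.map (Function.Embedding.subtype _) := by
      intro v hv
      simp only [mem_filter, mem_univ, true_and, F, mem_image] at hv
      obtain ⟨w, hw, hα⟩ := hv
      rw [q_eq hw] at hα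
      refine mem_biUnion.2 ⟨qe hw, by simpa using hα, ?_⟩
      simp only [mem_map, Sym2.mem_toFinset]
      exact ⟨⟨v, Q.edge_vert hw⟩, Sym2.mem_mk_left _ _, rfl⟩
    have hclass : #({e | φ₀ e = α} : Finset Q.coe.edgeSet) ≤ m := by
      by_cases hα : α ∈ Icc 1 k
      · have := hcol α hα
        rwa [Set.ncard_eq_toFinset_card', Set.toFinset_ofPred] at this
      · rw [card_eq_zero.2]
        · exact Nat.zero_le _
        · ext e
          simpa using fun (h : φ₀ e = α) => hα (h ▸ hφ₀.mem_Icc e)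
    refine (card_le_card hsub).trans ((card_biUnion_le_card_mul _ _ 2 fun e _ => ?_).trans ?_)
    · rw [card_map, Sym2.card_toFinset]
      split_ifs <;> omega
    · rw [mul_comm]; exact Nat.mul_le_mul_left 2 hclass
  obtain ⟨f, hf⟩ := exists_isAvoidingColoring H (Icc 1 (G.maxDegree + 4 * c * m - 1)) F hc hm
    (by convert hdeg) (fun v => (hFQ v).trans (hQdeg v)) (by convert hFα)
    (by rw [Nat.card_Icc]; omega)
  let p : V → V → ℕ := fun a b => if Q.Adj a b then q a b else f a b
  have pQ : ∀ {a b}, Q.Adj a b → p a b = q a b := fun h => if_pos h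
  have pH : ∀ {a b}, ¬ Q.Adj a b → p a b = f a b := fun h => if_neg h
  have p_symm : ∀ a b, G.Adj a b → p b a = p a b := by
    intro a b h
    by_cases hab : Q.Adj a b
    · rw [pQ hab, pQ hab.symm, q_symm hab]
    · rw [pH hab, pH (fun h => hab h.symm), hf.symm ((hH a b).2 ⟨h, hab⟩)]
  have hmixed : ∀ {a b b'}, Q.Adj a b → G.Adj a b' → ¬ Q.Adj a b' → p a b ≠ p a b' := by
    intro a b b' h h' hn heq
    rw [pQ h, pH hn] at heq
    refine hf.avoid ((hH a b').2 ⟨h', hn⟩) ?_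
    rw [← heq]
    exact mem_image_of_mem _ (by simpa using h)
  have p_inj : ∀ {a b b'}, G.Adj a b → G.Adj a b' → p a b = p a b' → b = b' := by
    intro a b b' h h' heq
    by_cases hb : Q.Adj a b <;> by_cases hb' : Q.Adj a b'
    · exact q_inj hb hb' (by rwa [pQ hb, pQ hb'] at heq)
    · exact absurd heq (hmixed hb h' hb')
    · exact absurd heq.symm (hmixed hb' h hb)
    · rw [pH hb, pH hb'] at heq
      exact hf.inj ((hH a b).2 ⟨h, hb⟩) ((hH a b').2 ⟨h', hb'⟩) heq
  obtain ⟨φ, hφ⟩ : ∃ φ : G.EdgeLabeling ℕ, ∀ a b (h : s(a, b) ∈ G.edgeSet), φ ⟨s(a, b), h⟩ = p a b :=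
    ⟨SimpleGraph.EdgeLabeling.mk (fun a b _ => p a b) p_symm, fun _ _ _ => rfl⟩
  refine ⟨φ, ⟨?_, ?_⟩, ?_⟩
  · rintro ⟨e, he⟩
    induction e with
    | _ a b =>
    rw [hφ]
    by_cases hab : Q.Adj a b
    · rw [pQ hab, q_eq hab]
      exact Icc_subset_Icc_right (le_max_left _ _) (hφ₀.mem_Icc _)
    · rw [pH hab]
      exact Icc_subset_Icc_right (le_max_right _ _) (hf.mem ((hH a b).2 ⟨he, hab⟩))
  · rintro ⟨e₁, he₁⟩ ⟨e₂, he₂⟩ hadj heq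
    obtain ⟨hne, v, hv₁, hv₂⟩ := SimpleGraph.lineGraph_adj_iff_exists.1 hadj
    obtain ⟨a, rfl⟩ := hv₁
    obtain ⟨b, rfl⟩ := hv₂
    rw [hφ, hφ] at heq
    obtain rfl := p_inj he₁ he₂ heq
    exact hne rfl
  · rintro ⟨e, he⟩
    induction e with
    | _ a b =>
    have hab : Q.Adj a b := he
    exact (hφ a b hab.adj_sub).trans ((pQ hab).trans (q_eq hab))
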